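/- An $(M,N;m,n)_k$-sub-perfect map ($M,N,m,n\ge 1$) is a cyclic two-dimensional array of shape $(M,N)$ (rows read modulo $M$, columns modulo $N$) over an alphabet of $k$ letters in which every pattern of shape $(m,n)$ occurs at most once. For $k>2$, a set $\mathcal M$ of sub-perfect maps over an alphabet of size $k$ is called a *family of almost perfect maps* if (i) for all $m',n'\ge 1$ it contains an $(M,N;m,n)_k$-sub-perfect map with $m>m'$ and $n>n'$, and (ii) for every sequence $(A_i)_{i\in\mathbb N}$ in $\mathcal M$, $A_i$ of type $(M_i,N_i;m_i,n_i)_k$, with $m_i<m_j$ and $n_i<n_j$ whenever $i<j$, one has $$\lim_{i\to\infty}\frac{M_iN_i}{k^{m_in_i}}=1 .$$ Let $\mathrm M(k,m)=\frac1m\sum_{d\mid m}\mu\!\left(\frac md\right)k^d$ be the necklace polynomial. **Theorem.** Let $k=k_1k_2$ with integers $k_1,k_2\ge 2$, and fix an alphabet of size $k$. Consider the set of all $(M,N;m,n)_k$-sub-perfect maps over this alphabet with $m,n\ge 2$, $|m-n|\le 2$, $$M=m\left(\mathrm M(k_2^m,n)-|m'-1|\cdot[m'<m-1]\right),\qquad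 N=n\left(\mathrm M(k_1^n,m)-|n'-1|\cdot[n'<n-1]\right),$$ where $m'=\mathrm M(k_2^m,n)\bmod m$, $n'=\mathrm M(k_1^n,m)\bmod n$, and $[\,\cdot\,]$ is $1$ if the condition holds and $0$ otherwise. This set is a family of almost perfect maps. -/

import Mathlib

/-- The necklace polynomial `M(k, m) = (1/m) ∑_{d ∣ m} μ(m/d) k^d`, the number of Lyndon words of
length `m` over `k` letters. For `m ≥ 1` the sum is a multiple of `m`, so the integer division is
exact. -/
def necklace (k m : ℕ) : ℤ :=
  (∑ d ∈ m.divisors, ArithmeticFunction.moebius (m / d) * (k : ℤ) ^ d) / (m : ℤ)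

/-- The pattern of shape `(m, n)` that occurs in the cyclic array `A` of shape `(M, N)` at
position `p`; row indices are read modulo `M`, column indices modulo `N`. -/
def patternAt {α : Type*} {M N : ℕ} (A : ZMod M → ZMod N → α) (m n : ℕ) (p : ZMod M × ZMod N) :
    Fin m → Fin n → α :=
  fun a b => A (p.1 + ((a : ℕ) : ZMod M)) (p.2 + ((b : ℕ) : ZMod N))

/-- An `(M, N; m, n)`-sub-perfect map over the alphabet `α`, together with its type: a cyclic array
of shape `(M, N)` in which every pattern of shape `(m, n)` occurs at no more than one position. -/
structure SubPerfectMap (α : Type*) where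
  M : ℕ
  N : ℕ
  m : ℕ
  n : ℕ
  M_pos : 0 < M
  N_pos : 0 < N
  m_pos : 0 < m
  n_pos : 0 < n
  array : ZMod M → ZMod N → α
  occurs_at_most_once : ∀ P : Fin m → Fin n → α, ∀ p q : ZMod M × ZMod N,
    patternAt array m n p = P → patternAt array m n q = P → p = q

/-- A sequence of sub-perfect maps is increasing if both side lengths of the pattern shape
strictly increase. -/
def IsIncreasing {α : Type*} (A : ℕ → SubPerfectMap α) : Prop :=
  ∀ i j : ℕ, i < j → (A i).m < (A j).m ∧ (A i).n < (A j).n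

/-- A set `S` of sub-perfect maps over an alphabet with `k > 2` letters is a family of almost
perfect maps if it has members of arbitrarily large pattern shape and, for every increasing
sequence in `S` of types `(M_i, N_i; m_i, n_i)`, the ratio `M_i N_i / k^(m_i n_i)` tends to `1`. -/
structure IsAlmostPerfectFamily {α : Type*} [Fintype α] (S : Set (SubPerfectMap α)) : Prop where
  two_lt_card : 2 < Fintype.card α
  exists_large : ∀ m' n' : ℕ, 1 ≤ m' → 1 ≤ n' → ∃ A ∈ S, m' < A.m ∧ n' < A.n
  tendsto_one : ∀ A : ℕ → SubPerfectMap α, (∀ i, A i ∈ S) → IsIncreasing A →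
    Filter.Tendsto
      (fun i => (((A i).M : ℝ) * ((A i).N : ℝ)) /
        (Fintype.card α : ℝ) ^ ((A i).m * (A i).n))
      Filter.atTop (nhds 1)

/-- `|r - 1| · [r < s - 1]` with `r = L mod s`: the number by which a ring length `L` is shortened
to make it coprime to `s`. -/
def ringReduction (L : ℤ) (s : ℕ) : ℤ :=
  if L % (s : ℤ) < (s : ℤ) - 1 then |L % (s : ℤ) - 1| else 0

/-- The sub-perfect maps over `α` (an alphabet of size `k₁ k₂`) of type `(M, N; m, n)`, where
`m, n ≥ 2`, `|m - n| ≤ 2`, `M = m (M(k₂^m, n) - |m' - 1| [m' < m - 1])` and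
`N = n (M(k₁^n, m) - |n' - 1| [n' < n - 1])` with `m' = M(k₂^m, n) mod m` and
`n' = M(k₁^n, m) mod n`. -/
def stackedRingMaps (α : Type*) (k₁ k₂ : ℕ) : Set (SubPerfectMap α) :=
  {A | 2 ≤ A.m ∧ 2 ≤ A.n ∧ |(A.m : ℤ) - (A.n : ℤ)| ≤ 2 ∧
    (A.M : ℤ) = A.m * (necklace (k₂ ^ A.m) A.n - ringReduction (necklace (k₂ ^ A.m) A.n) A.m) ∧
    (A.N : ℤ) = A.n * (necklace (k₁ ^ A.n) A.m - ringReduction (necklace (k₁ ^ A.n) A.m) A.n)}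

/-! The limit is a size estimate: `n * necklace (k ^ m) n` is `k ^ (m * n)` up to a relative error
of order `n / k ^ m`, and the reduction costs even less. As `|m - n| ≤ 2`, both factors of the area
tend to `1` after normalisation (`tendsto_reduced_necklace_div`).

Arbitrarily large members are only needed for `m = n = p` with `p ≥ 3` prime. Take the graph whose
edges are aperiodic stacks of `p` rings of length `p` modulo rotation, leading from the top `p - 1`
rings to the bottom `p - 1`. It is balanced and connected, and an Eulerian circuit unrolls to a
cyclic `L × p` array with distinct `p × p` patterns. Deleting one loop, the class of a stack of
equal rings, preserves balance and makes `L` one less than the necklace number. That number is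
divisible by `p`, so `L` is coprime to `p`. Superposing one such array over `k₂` letters and the
transpose of one over `k₁` letters determines both coordinates of a position by the Chinese
remainder theorem (`patternAt_superposition_injective`). -/

/-! ### Eulerian circuits as single-cycle permutations of the edges -/

/-- Composing with a transposition of points in different cycles merges these cycles. -/
theorem Equiv.Perm.sameCycle_mul_swap_of_not_sameCycle {E : Type*} [Finite E] [DecidableEq E]
    (σ : Equiv.Perm E) {e f : E} (hef : ¬ σ.SameCycle e f) :
    (σ * Equiv.swap e f).SameCycle e f := by
  set τ := σ * Equiv.swap e f with hτ
  have hτe : τ e = σ f := by simp [hτ]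
  -- From `τ e = σ f` on, `τ` follows the `σ`-cycle of `f`, which avoids `e`, until it reaches `f`.
  have key : ∀ k : ℕ, τ.SameCycle e f ∨ τ.SameCycle e ((σ ^ k) (σ f)) := by
    intro k
    induction k with
    | zero =>
      right
      rw [pow_zero, Equiv.Perm.one_apply, ← hτe]
      exact Equiv.Perm.sameCycle_apply_right.2 (Equiv.Perm.SameCycle.refl _ _)
    | succ k ih =>
      rcases ih with ih | ih
      · exact Or.inl ih
      by_cases hx : (σ ^ k) (σ f) = f
      · left; rwa [hx] at ih
      right
      have hxe : (σ ^ k) (σ f) ≠ e := by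
        intro h
        apply hef
        rw [← h]
        exact Equiv.Perm.sameCycle_pow_left.2
          (Equiv.Perm.sameCycle_apply_left.2 (Equiv.Perm.SameCycle.refl _ _))
      have : τ ((σ ^ k) (σ f)) = (σ ^ (k + 1)) (σ f) := by
        rw [hτ, Equiv.Perm.mul_apply, Equiv.swap_apply_of_ne_of_ne hxe hx, pow_succ',
          Equiv.Perm.mul_apply]
      rw [← this]
      exact Equiv.Perm.sameCycle_apply_right.2 ih
  obtain ⟨k, hk⟩ := (Equiv.Perm.sameCycle_apply_left.2
    (Equiv.Perm.SameCycle.refl σ f)).exists_nat_pow_eq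
  rcases key k with h | h
  · exact h
  · rwa [hk] at h

/-- No cycle is split: only the images of `e` and `f` are exchanged, and these two points now share
a cycle. -/
theorem Equiv.Perm.SameCycle.mul_swap {E : Type*} [Finite E] [DecidableEq E]
    {σ : Equiv.Perm E} {e f : E} (hef : ¬ σ.SameCycle e f) {x y : E} (h : σ.SameCycle x y) :
    (σ * Equiv.swap e f).SameCycle x y := by
  have hm := σ.sameCycle_mul_swap_of_not_sameCycle hef
  set τ := σ * Equiv.swap e f with hτ
  have one : ∀ x, τ.SameCycle x (σ x) := by
    intro x
    by_cases hxe : x = e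
    · have : τ f = σ x := by simp [hτ, hxe]
      rw [← this, hxe]
      exact Equiv.Perm.sameCycle_apply_right.2 hm
    by_cases hxf : x = f
    · have : τ e = σ x := by simp [hτ, hxf]
      rw [← this, hxf]
      exact Equiv.Perm.sameCycle_apply_right.2 hm.symm
    · have : τ x = σ x := by
        rw [hτ, Equiv.Perm.mul_apply, Equiv.swap_apply_of_ne_of_ne hxe hxf]
      rw [← this]
      exact Equiv.Perm.sameCycle_apply_right.2 (Equiv.Perm.SameCycle.refl _ _)
  obtain ⟨k, rfl⟩ := h.exists_nat_pow_eq
  clear h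
  induction k with
  | zero => exact Equiv.Perm.SameCycle.refl _ _
  | succ k ih =>
    rw [pow_succ', Equiv.Perm.mul_apply]
    exact ih.trans (one _)

/-- Euler's theorem for finite directed multigraphs: a permutation `σ₀` of the edges sending every
edge to one that starts where it ends witnesses that the graph is balanced; if moreover the graph
is connected, then there is such a permutation consisting of a single cycle. -/
theorem exists_eulerian_perm {E V : Type*} [Finite E] (src tgt : E → V) (σ₀ : Equiv.Perm E)
    (h₀ : ∀ e, src (σ₀ e) = tgt e)
    (conn : ∀ Q : E → Prop, (∀ e f, src f = tgt e → (Q e ↔ Q f)) → ∀ e f, Q e → Q f) :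
    ∃ σ : Equiv.Perm E, (∀ e, src (σ e) = tgt e) ∧ ∀ e f, σ.SameCycle e f := by
  classical
  rcases isEmpty_or_nonempty E with hE | ⟨⟨e₀⟩⟩
  · exact ⟨σ₀, h₀, fun e => isEmptyElim e⟩
  let T : Set (Equiv.Perm E) := {σ | ∀ e, src (σ e) = tgt e}
  -- Maximise the cycle through `e₀`. If it misses an edge, connectivity yields edges inside and
  -- outside it with a common target; swapping their successors enlarges it.
  obtain ⟨σ, hσT, hmax⟩ := Set.exists_max_image T
    (fun σ => Set.ncard {f | σ.SameCycle e₀ f}) (Set.toFinite _) ⟨σ₀, h₀⟩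
  refine ⟨σ, hσT, ?_⟩
  suffices hall : ∀ f, σ.SameCycle e₀ f from fun e f => (hall e).symm.trans (hall f)
  by_cases hclosed : ∀ e f, tgt e = tgt f → σ.SameCycle e₀ e → σ.SameCycle e₀ f
  · refine fun f => conn (fun e => σ.SameCycle e₀ e) ?_ e₀ f (Equiv.Perm.SameCycle.refl _ _)
    intro e f hef
    have hf : tgt (σ⁻¹ f) = src f := by rw [← hσT (σ⁻¹ f)]; simp
    have hf' : σ.SameCycle e₀ (σ⁻¹ f) ↔ σ.SameCycle e₀ f := by
      rw [← Equiv.Perm.sameCycle_apply_right]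
      simp
    rw [← hf']
    exact ⟨hclosed _ _ (by rw [hf, hef]), hclosed _ _ (by rw [hf, hef])⟩
  · exfalso
    push Not at hclosed
    obtain ⟨e, f, hef, he, hf⟩ := hclosed
    have hn : ¬ σ.SameCycle e f := fun h => hf (he.trans h)
    have hT : σ * Equiv.swap e f ∈ T := by
      intro x
      rw [Equiv.Perm.mul_apply, hσT]
      by_cases hxe : x = e
      · simp [hxe, hef]
      by_cases hxf : x = f
      · simp [hxf, hef]
      · rw [Equiv.swap_apply_of_ne_of_ne hxe hxf]
    refine absurd (hmax _ hT) (not_le.2 ?_)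
    refine Set.ncard_lt_ncard ⟨fun x hx => hx.mul_swap hn, fun h => hf (h ?_)⟩ (Set.toFinite _)
    exact (he.mul_swap hn).trans (σ.sameCycle_mul_swap_of_not_sameCycle hn)

/-! ### Stacks of rings modulo rotation, and their graph -/

/-- Cyclic rotation of all columns of an array with rows indexed by `ι` and cyclic columns. -/
def rotateColumns {ι β : Type*} {n : ℕ} (g : ZMod n) (w : ι → ZMod n → β) : ι → ZMod n → β :=
  fun i j => w i (j + g)

theorem rotateColumns_zero {ι β : Type*} {n : ℕ} (w : ι → ZMod n → β) :
    rotateColumns 0 w = w := by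
  funext i j; simp [rotateColumns]

theorem rotateColumns_rotateColumns {ι β : Type*} {n : ℕ} (g h : ZMod n) (w : ι → ZMod n → β) :
    rotateColumns g (rotateColumns h w) = rotateColumns (g + h) w := by
  funext i j; simp [rotateColumns, add_assoc]

theorem rotateColumns_comp {ι κ β : Type*} {n : ℕ} (g : ZMod n) (w : ι → ZMod n → β) (f : κ → ι) :
    rotateColumns g (w ∘ f) = rotateColumns g w ∘ f := rfl

theorem rotateColumns_neg_eq {ι β : Type*} {n : ℕ} {g : ZMod n} {u v : ι → ZMod n → β}
    (h : rotateColumns g u = v) : rotateColumns (-g) v = u := by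
  rw [← h, rotateColumns_rotateColumns, neg_add_cancel, rotateColumns_zero]

/-- Two arrays are equivalent if they differ by a rotation of the columns. -/
def columnSetoid (ι : Type*) (n : ℕ) (β : Type*) : Setoid (ι → ZMod n → β) where
  r u v := ∃ g, rotateColumns g u = v
  iseqv :=
    { refl := fun u => ⟨0, rotateColumns_zero u⟩
      symm := fun ⟨g, h⟩ => ⟨-g, rotateColumns_neg_eq h⟩
      trans := fun ⟨g, h⟩ ⟨g', h'⟩ => ⟨g' + g, by
        rw [← rotateColumns_rotateColumns, h, h']⟩ }

/-- The restriction of `columnSetoid` to a set of stacks of `d + 1` rings of length `n`. -/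
def stackSetoid {d n : ℕ} {β : Type*} (G : Set (Fin (d + 1) → ZMod n → β)) : Setoid G :=
  (columnSetoid (Fin (d + 1)) n β).comap Subtype.val

/-- The class modulo rotation of the `d` top rings of a stack. -/
def topRings {d n : ℕ} {β : Type*} (G : Set (Fin (d + 1) → ZMod n → β)) :
    Quotient (stackSetoid G) → Quotient (columnSetoid (Fin d) n β) :=
  Quotient.map (fun w => w.1 ∘ Fin.castSucc) fun u v ⟨g, h⟩ => ⟨g, by
    rw [rotateColumns_comp, h]⟩

/-- The class modulo rotation of the `d` bottom rings of a stack. -/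
def bottomRings {d n : ℕ} {β : Type*} (G : Set (Fin (d + 1) → ZMod n → β)) :
    Quotient (stackSetoid G) → Quotient (columnSetoid (Fin d) n β) :=
  Quotient.map (fun w => w.1 ∘ Fin.succ) fun u v ⟨g, h⟩ => ⟨g, by
    rw [rotateColumns_comp, h]⟩

/-- A single-cycle permutation of the classes of aperiodic stacks that follows the shift of rows
lifts to a cyclic array. It closes up if one of the stacks starts with constant rings. -/
theorem exists_array_of_eulerian_perm {d n : ℕ} {β : Type*} [Finite β] [NeZero n]
    (G : Set (Fin (d + 1) → ZMod n → β))
    (hrot : ∀ g, ∀ w ∈ G, rotateColumns g w ∈ G)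
    (hfree : ∀ g, ∀ w ∈ G, rotateColumns g w = w → g = 0)
    (σ : Equiv.Perm (Quotient (stackSetoid G)))
    (hσ : ∀ e, topRings G (σ e) = bottomRings G e)
    (hcyc : ∀ e f, σ.SameCycle e f) {w₀ : Fin (d + 1) → ZMod n → β} (hw₀ : w₀ ∈ G) {b : β}
    (hb : ∀ (i : Fin d) j, w₀ i.castSucc j = b) :
    ∃ A : ZMod (Nat.card (Quotient (stackSetoid G))) → ZMod n → β,
      Function.Injective (patternAt A (d + 1) n) := by
  classical
  let _ : Fintype (Quotient (stackSetoid G)) := Fintype.ofFinite _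
  set L := Nat.card (Quotient (stackSetoid G)) with hL
  have hLcard : (Finset.univ : Finset (Quotient (stackSetoid G))).card = L := by
    rw [hL, Nat.card_eq_fintype_card, Finset.card_univ]
  have hLpos : 0 < L := by
    rw [hL]
    have : Nonempty (Quotient (stackSetoid G)) := ⟨Quotient.mk _ ⟨w₀, hw₀⟩⟩
    exact Nat.card_pos
  have : NeZero L := ⟨hLpos.ne'⟩
  have hon : σ.IsCycleOn ((Finset.univ : Finset (Quotient (stackSetoid G))) : Set _) :=
    ⟨by simp, fun e _ f _ => hcyc e f⟩
  have hstep : ∀ w : G, ∃ w' : G, Quotient.mk (stackSetoid G) w' = σ (Quotient.mk _ w) ∧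
      w'.1 ∘ Fin.castSucc = w.1 ∘ Fin.succ := by
    intro w
    obtain ⟨u, hu⟩ := Quotient.exists_rep (σ (Quotient.mk (stackSetoid G) w))
    have h := hσ (Quotient.mk _ w)
    rw [← hu] at h
    obtain ⟨g, hg⟩ : ∃ g, rotateColumns g (u.1 ∘ Fin.castSucc) = w.1 ∘ Fin.succ :=
      Quotient.exact h
    refine ⟨⟨rotateColumns g u.1, hrot _ _ u.2⟩, ?_, hg⟩
    rw [← hu]
    exact Quotient.sound ⟨-g, rotateColumns_neg_eq rfl⟩
  choose step hstep₁ hstep₂ using hstep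
  let s : ℕ → G := fun i => step^[i] ⟨w₀, hw₀⟩
  have hs_succ : ∀ i, s (i + 1) = step (s i) := fun i => Function.iterate_succ_apply' _ _ _
  have hs_class : ∀ i, Quotient.mk (stackSetoid G) (s i) =
      (σ ^ i) (Quotient.mk _ ⟨w₀, hw₀⟩) := by
    intro i
    induction i with
    | zero => rfl
    | succ i ih => rw [hs_succ, hstep₁, ih, pow_succ', Equiv.Perm.mul_apply]
  let row : ℕ → ZMod n → β := fun i => (s i).1 0
  have hrow : ∀ (j : ℕ) (hj : j < d + 1) (i : ℕ), (s i).1 ⟨j, hj⟩ = row (i + j) := by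
    intro j
    induction j with
    | zero => intro _ i; rfl
    | succ j ih =>
      intro hj i
      have h1 := congrFun (hstep₂ (s i)) ⟨j, by omega⟩
      rw [← hs_succ] at h1
      have h2 := ih (by omega) (i + 1)
      rw [show i + (j + 1) = i + 1 + j by omega, ← h2]
      exact h1.symm
  have hclass_inj : ∀ i j, Quotient.mk (stackSetoid G) (s i) = Quotient.mk _ (s j) ↔
      i ≡ j [MOD L] := by
    intro i j
    rw [hs_class, hs_class, hon.pow_apply_eq_pow_apply (Finset.mem_univ _), hLcard]
  have hconst : ∀ a < d, row a = fun _ => b := by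
    intro a ha
    have := hrow a (by omega) 0
    rw [zero_add] at this
    rw [← this]
    funext j
    exact hb ⟨a, ha⟩ j
  -- After `L` steps the stack returns only up to a rotation, which constant rings do not see.
  have hconstL : ∀ a < d, row (L + a) = fun _ => b := by
    intro a ha
    obtain ⟨g, hg⟩ : ∃ g, rotateColumns g (s 0).1 = (s L).1 :=
      Quotient.exact ((hclass_inj 0 L).2 (by simp [Nat.ModEq]))
    rw [← hrow a (by omega) L, ← hg]
    funext j
    exact hb ⟨a, ha⟩ _
  -- Windows starting below `L` reach at most row `L - 1 + d`, so periodicity is needed only this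
  -- far.
  have hmod : ∀ a < L + d, row (a % L) = row a := by
    intro a
    induction a using Nat.strong_induction_on with
    | _ a ih =>
      intro ha
      rcases lt_or_ge a L with h | h
      · rw [Nat.mod_eq_of_lt h]
      · rw [Nat.mod_eq_sub_mod h, ih (a - L) (by omega) (by omega), hconst _ (by omega),
          ← hconstL (a - L) (by omega), Nat.add_sub_cancel' h]
  refine ⟨fun i => row i.val, fun p q hpq => ?_⟩
  have hwin : ∀ (p : ZMod L × ZMod n) (a : Fin (d + 1)) (c : ZMod n),
      patternAt (fun i : ZMod L => row i.val) (d + 1) n p a ⟨c.val, c.val_lt⟩ =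
        rotateColumns p.2 (s p.1.val).1 a c := by
    intro p a c
    have hv : (p.1 + ((a : ℕ) : ZMod L)).val = (p.1.val + a) % L := by
      rw [ZMod.val_add, ZMod.val_natCast, Nat.add_mod_mod]
    have hlt := p.1.val_lt
    simp only [patternAt, rotateColumns]
    rw [hv, hmod _ (by omega), ZMod.natCast_zmod_val, add_comm c, hrow a.1 a.2]
  have heq : rotateColumns p.2 (s p.1.val).1 = rotateColumns q.2 (s q.1.val).1 := by
    funext a c
    rw [← hwin, ← hwin, hpq]
  have hrot_eq : rotateColumns (-q.2 + p.2) (s p.1.val).1 = (s q.1.val).1 := by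
    rw [← rotateColumns_rotateColumns]
    exact rotateColumns_neg_eq heq.symm
  have hval : p.1.val = q.1.val := by
    have h := (hclass_inj p.1.val q.1.val).1 (Quotient.sound ⟨_, hrot_eq⟩)
    exact Nat.ModEq.eq_of_lt_of_lt h p.1.val_lt q.1.val_lt
  have h1 : p.1 = q.1 := ZMod.val_injective L hval
  have h2 : -q.2 + p.2 = 0 := hfree _ _ (s p.1.val).2 (by rw [hrot_eq, hval])
  exact Prod.ext h1 (neg_add_eq_zero.1 h2).symm

/-- Rotation acts freely on `G`, so every class has `n` elements. -/
theorem card_quotient_stackSetoid_mul {d n : ℕ} {β : Type*} [NeZero n]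
    (G : Set (Fin (d + 1) → ZMod n → β))
    (hrot : ∀ g, ∀ w ∈ G, rotateColumns g w ∈ G)
    (hfree : ∀ g, ∀ w ∈ G, rotateColumns g w = w → g = 0) :
    Nat.card (Quotient (stackSetoid G)) * n = Nat.card G := by
  calc _ = Nat.card (Quotient (stackSetoid G) × ZMod n) := by rw [Nat.card_prod, Nat.card_zmod]
    _ = _ := ?_
  refine Nat.card_congr (Equiv.ofBijective
    (fun x => ⟨rotateColumns x.2 x.1.out.1, hrot _ _ x.1.out.2⟩) ⟨?_, ?_⟩)
  · rintro ⟨e, g⟩ ⟨f, h⟩ heq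
    have heq' : rotateColumns g e.out.1 = rotateColumns h f.out.1 := congrArg Subtype.val heq
    have hr : rotateColumns (-h + g) e.out.1 = f.out.1 := by
      rw [← rotateColumns_rotateColumns]
      exact rotateColumns_neg_eq heq'.symm
    have hef : e = f := by
      rw [← e.out_eq, ← f.out_eq]
      exact Quotient.sound ⟨_, hr⟩
    subst hef
    have := hfree _ _ e.out.2 hr
    rw [neg_add_eq_zero.1 this]
  · intro w
    obtain ⟨g, hg⟩ : ∃ g, rotateColumns g (Quotient.mk (stackSetoid G) w).out.1 = w.1 :=
      Quotient.exact (Quotient.out_eq (Quotient.mk (stackSetoid G) w))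
    exact ⟨(Quotient.mk _ w, g), Subtype.ext hg⟩

/-- The cyclic shift of the rows of a stack induces a permutation of the classes of stacks. -/
theorem exists_perm_topRings_eq_bottomRings {d n : ℕ} {β : Type*}
    (G : Set (Fin (d + 1) → ZMod n → β))
    (hG : ∀ w, w ∘ finRotate (d + 1) ∈ G ↔ w ∈ G) :
    ∃ σ : Equiv.Perm (Quotient (stackSetoid G)), ∀ e, topRings G (σ e) = bottomRings G e := by
  have hG' : ∀ w ∈ G, w ∘ (finRotate (d + 1)).symm ∈ G := fun w hw => by
    rw [← hG]
    convert hw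
    funext i
    simp
  refine ⟨{ toFun := Quotient.map (fun w => ⟨w.1 ∘ finRotate (d + 1), (hG _).2 w.2⟩)
              fun u v ⟨g, h⟩ => ⟨g, by dsimp only; rw [rotateColumns_comp, h]⟩
            invFun := Quotient.map (fun w => ⟨w.1 ∘ (finRotate (d + 1)).symm, hG' _ w.2⟩)
              fun u v ⟨g, h⟩ => ⟨g, by dsimp only; rw [rotateColumns_comp, h]⟩
            left_inv := ?_
            right_inv := ?_ }, ?_⟩
  · intro e
    induction e using Quotient.inductionOn with
    | _ w =>
      refine congrArg (Quotient.mk _) (Subtype.ext ?_)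
      funext i
      simp
  · intro e
    induction e using Quotient.inductionOn with
    | _ w =>
      refine congrArg (Quotient.mk _) (Subtype.ext ?_)
      funext i
      simp
  · intro e
    induction e using Quotient.inductionOn with
    | _ w =>
      refine congrArg (Quotient.mk _) ?_
      funext i
      simp

/-- If every stack containing the ring `z` is admissible, the graph of classes of admissible
stacks is connected: any stack is joined to the stack of copies of `z`. -/
theorem connected_of_forall_mem {d n : ℕ} {β : Type*} (G : Set (Fin (d + 1) → ZMod n → β))
    (z : ZMod n → β) (hz : ∀ w : Fin (d + 1) → ZMod n → β, (∃ i, w i = z) → w ∈ G)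
    (Q : Quotient (stackSetoid G) → Prop)
    (hQ : ∀ e f, topRings G f = bottomRings G e → (Q e ↔ Q f))
    (e f : Quotient (stackSetoid G)) (he : Q e) : Q f := by
  let wz : G := ⟨fun _ => z, hz _ ⟨0, rfl⟩⟩
  suffices h : ∀ w : G, Q (Quotient.mk _ w) ↔ Q (Quotient.mk _ wz) by
    induction e using Quotient.inductionOn with
    | _ u =>
      induction f using Quotient.inductionOn with
      | _ v => exact (h v).2 ((h u).1 he)
  intro w
  -- Push `w` out at the top while feeding copies of `z` in at the bottom; every later stack
  -- contains `z`, hence is admissible.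
  let t : ℕ → Fin (d + 1) → ZMod n → β := fun k i =>
    if h : (i : ℕ) + k < d + 1 then w.1 ⟨i + k, h⟩ else z
  have ht0 : t 0 = w.1 := by
    funext i
    exact dif_pos i.2
  have htG : ∀ k, t k ∈ G := by
    intro k
    rcases k with _ | k
    · rw [ht0]; exact w.2
    · refine hz _ ⟨Fin.last d, ?_⟩
      simp [t]
  have hall : ∀ k, Q (Quotient.mk _ w) ↔ Q (Quotient.mk _ ⟨t k, htG k⟩) := by
    intro k
    induction k with
    | zero => simp only [ht0]
    | succ k ih =>
      rw [ih]
      refine hQ _ _ (congrArg (Quotient.mk _) ?_)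
      funext i
      simp [t, add_comm, add_left_comm]
  have hend : t (d + 1) = wz.1 := by
    funext i
    exact dif_neg (by omega)
  rw [hall (d + 1)]
  simp only [hend]

/-! ### Asymptotics of the reduced ring lengths -/

theorem abs_ringReduction_le (L : ℤ) {s : ℕ} (hs : 1 ≤ s) : |ringReduction L s| ≤ s := by
  unfold ringReduction
  have h1 := Int.emod_nonneg L (b := s) (by omega)
  have h2 := Int.emod_lt_of_pos L (b := s) (by omega)
  split_ifs
  · rw [abs_abs, abs_le]
    constructor <;> omega
  · simp

theorem abs_mul_necklace_sub_pow_le {K n : ℕ} (hK : 1 ≤ K) (hn : 1 ≤ n) :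
    |(n : ℤ) * necklace K n - (K : ℤ) ^ n| ≤ n * (K : ℤ) ^ (n - 1) + n := by
  unfold necklace
  set S := ∑ d ∈ n.divisors, ArithmeticFunction.moebius (n / d) * (K : ℤ) ^ d with hS
  have hK' : (1 : ℤ) ≤ K := by exact_mod_cast hK
  -- The remainder bound suffices here; exactness of the division is not needed.
  have hdiv : |(n : ℤ) * (S / n) - S| ≤ n := by
    have h1 := Int.emod_nonneg S (b := n) (by omega)
    have h2 := Int.emod_lt_of_pos S (b := n) (by omega)
    have h3 := Int.mul_ediv_add_emod S n
    rw [abs_le]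
    constructor <;> linarith
  have hsum : |S - (K : ℤ) ^ n| ≤ n * (K : ℤ) ^ (n - 1) := by
    have h1 : S - (K : ℤ) ^ n =
        ∑ d ∈ n.properDivisors, ArithmeticFunction.moebius (n / d) * (K : ℤ) ^ d := by
      rw [hS, ← Nat.insert_self_properDivisors (by omega),
        Finset.sum_insert Nat.self_notMem_properDivisors, Nat.div_self hn]
      simp
    rw [h1]
    calc _ ≤ ∑ d ∈ n.properDivisors, |ArithmeticFunction.moebius (n / d) * (K : ℤ) ^ d| :=
          Finset.abs_sum_le_sum_abs _ _
      _ ≤ ∑ d ∈ n.properDivisors, (K : ℤ) ^ (n - 1) := by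
          refine Finset.sum_le_sum fun d hd => ?_
          have hd' := (Nat.mem_properDivisors.1 hd).2
          rw [abs_mul, abs_of_nonneg (by positivity : (0 : ℤ) ≤ (K : ℤ) ^ d)]
          calc _ ≤ 1 * (K : ℤ) ^ d := by
                gcongr
                exact ArithmeticFunction.abs_moebius_le_one
            _ ≤ _ := by
                rw [one_mul]
                exact pow_le_pow_right₀ hK' (by omega)
      _ ≤ n * (K : ℤ) ^ (n - 1) := by
          rw [Finset.sum_const, nsmul_eq_mul]
          gcongr
          calc n.properDivisors.card ≤ (Finset.range n).card :=
                Finset.card_le_card fun d hd =>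
                  Finset.mem_range.2 (Nat.mem_properDivisors.1 hd).2
            _ = n := Finset.card_range n
  calc _ = |(n * (S / n) - S) + (S - (K : ℤ) ^ n)| := by ring_nf
    _ ≤ _ := (abs_add_le _ _).trans (by linarith)

/-- A reduced ring length `necklace (k ^ m) n - ringReduction _ m` is asymptotically
`k ^ (m * n) / n`. -/
theorem abs_reduced_necklace_div_sub_one_le {k m n : ℕ} (hk : 2 ≤ k) (hm : 1 ≤ m) (hn : 2 ≤ n)
    (hmn : n ≤ m + 2) :
    |(n : ℝ) * ((necklace (k ^ m) n - ringReduction (necklace (k ^ m) n) m : ℤ) : ℝ) /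
      (k : ℝ) ^ (m * n) - 1| ≤ ((m : ℝ) + 2) ^ 2 / 2 ^ m := by
  have hK : 1 ≤ k ^ m := Nat.one_le_pow _ _ (by omega)
  have hz : |(n : ℤ) * (necklace (k ^ m) n - ringReduction (necklace (k ^ m) n) m) -
      ((k ^ m : ℕ) : ℤ) ^ n| ≤ n * (m + 2) * ((k ^ m : ℕ) : ℤ) ^ (n - 1) := by
    have h1 := abs_mul_necklace_sub_pow_le hK (by omega : 1 ≤ n)
    have h2 := abs_ringReduction_le (necklace (k ^ m) n) hm
    have h3 : (1 : ℤ) ≤ ((k ^ m : ℕ) : ℤ) ^ (n - 1) := one_le_pow₀ (by exact_mod_cast hK)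
    set R := ringReduction (necklace (k ^ m) n) m
    set a := necklace (k ^ m) n
    set P := ((k ^ m : ℕ) : ℤ) ^ (n - 1)
    have h4 : |(n : ℤ) * R| ≤ n * m := by
      rw [abs_mul, Nat.abs_cast]; gcongr
    have h5 : (n : ℤ) * (m + 1) * 1 ≤ n * (m + 1) * P := by gcongr
    calc _ = |((n : ℤ) * a - ((k ^ m : ℕ) : ℤ) ^ n) - n * R| := by ring_nf
      _ ≤ _ := (abs_sub _ _).trans (by linarith)
  have hr : |(n : ℝ) * ((necklace (k ^ m) n - ringReduction (necklace (k ^ m) n) m : ℤ) : ℝ) -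
      ((k : ℝ) ^ m) ^ n| ≤ n * (m + 2) * ((k : ℝ) ^ m) ^ (n - 1) := by exact_mod_cast hz
  have hk0 : (0 : ℝ) < k := by exact_mod_cast (by omega : 0 < k)
  have hpos : (0 : ℝ) < (k : ℝ) ^ (m * n) := by positivity
  rw [div_sub_one hpos.ne', abs_div, abs_of_pos hpos, div_le_div_iff₀ hpos (by positivity)]
  rw [← pow_mul (k : ℝ) m n] at hr
  have hsplit : (k : ℝ) ^ (m * n) = ((k : ℝ) ^ m) ^ (n - 1) * (k : ℝ) ^ m := by
    rw [← pow_succ, ← pow_mul, Nat.sub_add_cancel (by omega)]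
  -- The closeness of `m` and `n` enters here: `n ≤ m + 2` turns the error into a function of `m`
  -- alone.
  calc _ ≤ (n * (m + 2) * ((k : ℝ) ^ m) ^ (n - 1)) * 2 ^ m := by gcongr
    _ ≤ ((m + 2 : ℝ) * (m + 2) * ((k : ℝ) ^ m) ^ (n - 1)) * (k : ℝ) ^ m := by
        gcongr
        · exact_mod_cast hmn
        · exact_mod_cast hk
    _ = _ := by rw [hsplit]; ring

theorem tendsto_add_two_sq_div_two_pow :
    Filter.Tendsto (fun m : ℕ => ((m : ℝ) + 2) ^ 2 / 2 ^ m) Filter.atTop (nhds 0) := by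
  have h := (tendsto_pow_const_div_const_pow_of_one_lt 2 (one_lt_two (α := ℝ)))
  have h2 := ((Filter.tendsto_add_atTop_iff_nat 2).2 h).const_mul 4
  rw [mul_zero] at h2
  refine h2.congr fun m => ?_
  push_cast
  rw [pow_add]
  field_simp
  norm_num

theorem tendsto_reduced_necklace_div {k : ℕ} (hk : 2 ≤ k) {m n : ℕ → ℕ} (hm : ∀ i, 1 ≤ m i)
    (hn : ∀ i, 2 ≤ n i) (hmn : ∀ i, n i ≤ m i + 2)
    (hlim : Filter.Tendsto m Filter.atTop Filter.atTop) :
    Filter.Tendsto (fun i => (n i : ℝ) * ((necklace (k ^ m i) (n i) -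
      ringReduction (necklace (k ^ m i) (n i)) (m i) : ℤ) : ℝ) / (k : ℝ) ^ (m i * n i))
      Filter.atTop (nhds 1) := by
  rw [tendsto_iff_dist_tendsto_zero]
  refine squeeze_zero (fun _ => dist_nonneg) (fun i => ?_)
    (tendsto_add_two_sq_div_two_pow.comp hlim)
  rw [Real.dist_eq]
  exact abs_reduced_necklace_div_sub_one_le hk (hm i) (hn i) (hmn i)

theorem tendsto_area_div_of_mem_stackedRingMaps {α : Type*} {k₁ k₂ : ℕ} (hk₁ : 2 ≤ k₁)
    (hk₂ : 2 ≤ k₂) (A : ℕ → SubPerfectMap α) (hA : ∀ i, A i ∈ stackedRingMaps α k₁ k₂)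
    (hinc : IsIncreasing A) :
    Filter.Tendsto (fun i => (((A i).M : ℝ) * ((A i).N : ℝ)) /
      ((k₁ * k₂ : ℕ) : ℝ) ^ ((A i).m * (A i).n)) Filter.atTop (nhds 1) := by
  have hm : Filter.Tendsto (fun i => (A i).m) Filter.atTop Filter.atTop :=
    StrictMono.tendsto_atTop fun i j hij => (hinc i j hij).1
  have hn : Filter.Tendsto (fun i => (A i).n) Filter.atTop Filter.atTop :=
    StrictMono.tendsto_atTop fun i j hij => (hinc i j hij).2
  have hd : ∀ i, (A i).m ≤ (A i).n + 2 ∧ (A i).n ≤ (A i).m + 2 := fun i => by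
    have := abs_le.1 (hA i).2.2.1
    omega
  have h := (tendsto_reduced_necklace_div hk₂ (fun i => (A i).m_pos) (fun i => (hA i).2.1)
    (fun i => (hd i).2) hm).mul (tendsto_reduced_necklace_div hk₁ (fun i => (A i).n_pos)
    (fun i => (hA i).1) (fun i => (hd i).1) hn)
  rw [one_mul] at h
  -- The outer factors `m` of `M` and `n` of `N` trade places: each ratio pairs a reduced length
  -- with the other factor.
  refine h.congr fun i => ?_
  obtain ⟨-, -, -, hM, hN⟩ := hA i
  have hM' := congrArg (Int.cast : ℤ → ℝ) hM
  have hN' := congrArg (Int.cast : ℤ → ℝ) hN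
  rw [Int.cast_mul, Int.cast_natCast, Int.cast_natCast] at hM' hN'
  rw [hM', hN', Nat.cast_mul, mul_pow, mul_comm (A i).n (A i).m, div_mul_div_comm]
  congr 1 <;> ring

/-! ### Aperiodic stacks of prime ring length -/

/-- The aperiodic stacks of rings that are not made of copies of one rotation of the ring `x`. -/
def aperiodicStacks {n : ℕ} {β : Type*} (d : ℕ) (x : ZMod n → β) :
    Set (Fin (d + 1) → ZMod n → β) :=
  {w | (∀ g, rotateColumns g w = w → g = 0) ∧ ∀ g, w ≠ rotateColumns g fun _ => x}

theorem rotateColumns_mem_aperiodicStacks {d n : ℕ} {β : Type*} {x : ZMod n → β} (h : ZMod n)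
    (w : Fin (d + 1) → ZMod n → β) (hw : w ∈ aperiodicStacks d x) :
    rotateColumns h w ∈ aperiodicStacks d x := by
  refine ⟨fun g hg => hw.1 g ?_, fun g hg => hw.2 (-h + g) ?_⟩
  · rw [rotateColumns_rotateColumns, add_comm g, ← rotateColumns_rotateColumns] at hg
    have := rotateColumns_neg_eq hg
    rwa [rotateColumns_rotateColumns, neg_add_cancel, rotateColumns_zero, eq_comm] at this
  · rw [← rotateColumns_rotateColumns, ← hg, rotateColumns_neg_eq rfl]

theorem comp_mem_aperiodicStacks {d n : ℕ} {β : Type*} {x : ZMod n → β}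
    (e : Equiv.Perm (Fin (d + 1))) {w : Fin (d + 1) → ZMod n → β}
    (hw : w ∈ aperiodicStacks d x) : w ∘ e ∈ aperiodicStacks d x := by
  refine ⟨fun g hg => hw.1 g ?_, fun g hg => hw.2 g ?_⟩
  · rw [rotateColumns_comp] at hg
    exact e.surjective.injective_comp_right hg
  · exact e.surjective.injective_comp_right hg

theorem comp_mem_aperiodicStacks_iff {d n : ℕ} {β : Type*} {x : ZMod n → β}
    (e : Equiv.Perm (Fin (d + 1))) (w : Fin (d + 1) → ZMod n → β) :
    w ∘ e ∈ aperiodicStacks d x ↔ w ∈ aperiodicStacks d x := by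
  refine ⟨fun h => ?_, comp_mem_aperiodicStacks e⟩
  convert comp_mem_aperiodicStacks e.symm h
  funext i
  simp

/-- A nonzero `g` generates `ZMod p`. -/
theorem eq_of_rotate_eq_of_prime {p : ℕ} [Fact p.Prime] {β : Type*} {x : ZMod p → β} {g : ZMod p}
    (hg : g ≠ 0) (hx : ∀ j, x (j + g) = x j) (j : ZMod p) : x j = x 0 := by
  have key : ∀ k : ℕ, x (k * g) = x 0 := by
    intro k
    induction k with
    | zero => simp
    | succ k ih => rw [← ih, ← hx (k * g)]; congr 1; push_cast; ring
  have := key (j * g⁻¹).val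
  rwa [ZMod.natCast_zmod_val, mul_assoc, inv_mul_cancel₀ hg, mul_one] at this

/-- The number of stacks is that of aperiodic ones, plus the stacks of constant rings, plus the
excluded orbit. -/
theorem card_aperiodicStacks_add {p d : ℕ} [Fact p.Prime] {β : Type*} [Finite β]
    {x : ZMod p → β} (hx : ∀ g, (∀ j, x (j + g) = x j) → g = 0) :
    Nat.card (aperiodicStacks d x) + (Nat.card β ^ (d + 1) + p) = Nat.card β ^ ((d + 1) * p) := by
  let c : (Fin (d + 1) → β) → Fin (d + 1) → ZMod p → β := fun v i _ => v i
  let l : ZMod p → Fin (d + 1) → ZMod p → β := fun g => rotateColumns g fun _ => x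
  have hp1 : (1 : ZMod p) ≠ 0 := one_ne_zero
  have hc : Function.Injective c := fun u v h => by
    funext i
    exact congrFun (congrFun h i) 0
  have hl : Function.Injective l := fun g h hgh => by
    have h1 : ∀ j, x (j + g) = x (j + h) := fun j => congrFun (congrFun hgh 0) j
    refine sub_eq_zero.1 (hx _ fun j => ?_)
    have := h1 (j - h)
    rw [sub_add_cancel] at this
    rw [← this]
    congr 1
    ring
  have hdisj : Disjoint (Set.range c) (Set.range l) := by
    rw [Set.disjoint_left]
    rintro _ ⟨v, rfl⟩ ⟨g, hg⟩
    refine hp1 (hx 1 fun j => ?_)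
    have h1 : ∀ j, x (j + g) = v 0 := fun j => congrFun (congrFun hg 0) j
    have h2 := h1 (j + 1 - g)
    have h3 := h1 (j - g)
    rw [sub_add_cancel] at h2 h3
    rw [h2, h3]
  -- By primality a stack with a nontrivial period has only constant rings.
  have hcompl : (aperiodicStacks d x)ᶜ = Set.range c ∪ Set.range l := by
    ext w
    constructor
    · intro hw
      by_cases h : ∀ g, rotateColumns g w = w → g = 0
      · by_contra hcon
        exact hw ⟨h, fun g hg => hcon (Or.inr ⟨g, hg.symm⟩)⟩
      · push Not at h
        obtain ⟨g, hg, hg0⟩ := h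
        refine Or.inl ⟨fun i => w i 0, ?_⟩
        funext i j
        exact (eq_of_rotate_eq_of_prime hg0 (fun j => congrFun (congrFun hg i) j) j).symm
    · rintro (⟨v, rfl⟩ | ⟨g, rfl⟩) hw
      · exact hp1 (hw.1 1 rfl)
      · exact hw.2 g rfl
  have h := Set.ncard_add_ncard_compl (aperiodicStacks d x)
  rw [hcompl, Set.ncard_union_eq hdisj, ← Set.image_univ, ← Set.image_univ,
    Set.ncard_image_of_injective _ hc, Set.ncard_image_of_injective _ hl, Set.ncard_univ,
    Set.ncard_univ, Nat.card_zmod, Nat.card_fun, Nat.card_fun, Nat.card_fun, Nat.card_zmod,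
    Nat.card_fin, ← pow_mul] at h
  rw [mul_comm, ← h]
  rfl

theorem exists_injective_patternAt {p d : ℕ} [Fact p.Prime] (hp : 3 ≤ p) {β : Type*}
    [Finite β] [Nontrivial β] :
    ∃ L : ℕ, 0 < L ∧ L * p + (Nat.card β ^ (d + 2) + p) = Nat.card β ^ ((d + 2) * p) ∧
      ∃ A : ZMod L → ZMod p → β, Function.Injective (patternAt A (d + 2) p) := by
  classical
  obtain ⟨a, b, hab⟩ := exists_pair_ne β
  have h10 : (1 : ZMod p) ≠ 0 := one_ne_zero
  have h20 : (2 : ZMod p) ≠ 0 := by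
    intro h
    have : p ∣ 2 := (ZMod.natCast_eq_zero_iff 2 p).1 (by exact_mod_cast h)
    exact absurd (Nat.le_of_dvd two_pos this) (by omega)
  let x : ZMod p → β := fun j => if j = 0 then b else a
  -- Two adjacent letters `b`: aperiodic because `p ≥ 3`, and not a rotation of `x`, so any stack
  -- containing `z` is admissible.
  let z : ZMod p → β := fun j => if j = 0 ∨ j = 1 then b else a
  have hxb : ∀ j, x j = b ↔ j = 0 := fun j => by
    by_cases h : j = 0 <;> simp [x, h, hab]
  have hzb : ∀ j, z j = b ↔ j = 0 ∨ j = 1 := fun j => by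
    by_cases h : j = 0 ∨ j = 1 <;> simp [z, h, hab]
  have hx : ∀ g, (∀ j, x (j + g) = x j) → g = 0 := by
    intro g hg
    have := hg 0
    rwa [(hxb 0).2 rfl, hxb, zero_add] at this
  have hz : ∀ g, (∀ j, z (j + g) = z j) → g = 0 := by
    intro g hg
    have h0 := hg 0
    have h1 := hg 1
    rw [(hzb 0).2 (Or.inl rfl), hzb, zero_add] at h0
    rw [(hzb 1).2 (Or.inr rfl), hzb] at h1
    rcases h0 with h0 | rfl
    · exact h0
    · rcases h1 with h1 | h1
      · exact absurd (by rw [← h1]; norm_num) h20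
      · exact add_eq_left.1 h1
  have hzG : ∀ w : Fin (d + 1 + 1) → ZMod p → β, (∃ i, w i = z) →
      w ∈ aperiodicStacks (d + 1) x := by
    rintro w ⟨i, hi⟩
    refine ⟨fun g hg => hz g fun j => ?_, fun g hg => ?_⟩
    · have := congrFun (congrFun hg i) j
      rwa [rotateColumns, hi] at this
    · have h : ∀ j, z j = x (j + g) := fun j => by
        rw [← hi, hg]; rfl
      have h0 := (hzb 0).2 (Or.inl rfl)
      have h1 := (hzb 1).2 (Or.inr rfl)
      rw [h, hxb] at h0 h1
      rw [zero_add] at h0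
      rw [h0, add_zero] at h1
      exact h10 h1
  have hfree : ∀ g, ∀ w ∈ aperiodicStacks (d + 1) x, rotateColumns g w = w → g = 0 :=
    fun g w hw => hw.1 g
  -- The ring `z` makes the stack admissible; the constant rings above it let the array close up.
  let w₀ : Fin (d + 1 + 1) → ZMod p → β := fun i => if i = Fin.last _ then z else fun _ => a
  have hw₀ : w₀ ∈ aperiodicStacks (d + 1) x := hzG _ ⟨Fin.last _, by simp [w₀]⟩
  obtain ⟨σ₀, hσ₀⟩ := exists_perm_topRings_eq_bottomRings (aperiodicStacks (d + 1) x)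
    (comp_mem_aperiodicStacks_iff _)
  obtain ⟨σ, hσ, hcyc⟩ := exists_eulerian_perm _ _ σ₀ hσ₀ (connected_of_forall_mem _ z hzG)
  refine ⟨Nat.card (Quotient (stackSetoid (aperiodicStacks (d + 1) x))), ?_, ?_,
    exists_array_of_eulerian_perm _ rotateColumns_mem_aperiodicStacks hfree σ hσ hcyc hw₀
      (b := a) ?_⟩
  · have : Nonempty (Quotient (stackSetoid (aperiodicStacks (d + 1) x))) :=
      ⟨Quotient.mk _ ⟨w₀, hw₀⟩⟩
    exact Nat.card_pos
  · rw [card_quotient_stackSetoid_mul _ rotateColumns_mem_aperiodicStacks hfree]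
    exact card_aperiodicStacks_add hx
  · intro i j
    simp [w₀, (Fin.castSucc_lt_last i).ne]

/-! ### Ring lengths for a prime and their coprimality -/

theorem necklace_prime {p : ℕ} (hp : p.Prime) (K : ℕ) :
    necklace K p = ((K : ℤ) ^ p - K) / p := by
  unfold necklace
  rw [hp.sum_divisors, Nat.div_self hp.pos, Nat.div_one,
    ArithmeticFunction.moebius_apply_prime hp]
  simp only [ArithmeticFunction.moebius_apply_one]
  congr 1
  ring

/-- Fermat's congruence `q ^ p ≡ q` modulo `p` lifts to modulus `p ^ 2` on taking `p`-th powers. -/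
theorem prime_sq_dvd_pow_sub_pow {p : ℕ} (hp : p.Prime) (q : ℤ) :
    (p : ℤ) ^ 2 ∣ q ^ (p * p) - q ^ p := by
  have := Fact.mk hp
  have h1 : (p : ℤ) ∣ q ^ p - q := by
    rw [← ZMod.intCast_zmod_eq_zero_iff_dvd]
    push_cast
    rw [ZMod.pow_card, sub_self]
  have h2 := dvd_sub_pow_of_dvd_sub h1 1
  simpa [pow_mul] using h2

theorem ringReduction_of_dvd {L : ℤ} {s : ℕ} (hs : 2 ≤ s) (h : (s : ℤ) ∣ L) :
    ringReduction L s = 1 := by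
  rw [ringReduction, Int.emod_eq_zero_of_dvd h, if_pos (by omega)]
  simp

/-- For a prime `p` the reduced ring length is realized by a cyclic array with distinct
`p × p` patterns, and it is coprime to `p`. -/
theorem exists_ring_array {p : ℕ} (hp : p.Prime) (hp3 : 3 ≤ p) {q : ℕ} (hq : 2 ≤ q) :
    ∃ L : ℕ, 0 < L ∧ p.Coprime L ∧
      (L : ℤ) = necklace (q ^ p) p - ringReduction (necklace (q ^ p) p) p ∧
      ∃ A : ZMod L → ZMod p → Fin q, Function.Injective (patternAt A p p) := by
  have := Fact.mk hp
  have : Nontrivial (Fin q) := Fin.nontrivial_iff_two_le.2 hq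
  obtain ⟨d, hd⟩ : ∃ d, p = d + 2 := ⟨p - 2, by omega⟩
  obtain ⟨L, hL, hcard, A, hA⟩ := exists_injective_patternAt (d := d) hp3 (β := Fin q)
  rw [← hd, Nat.card_fin] at hcard
  rw [← hd] at hA
  have hp0 : (p : ℤ) ≠ 0 := by exact_mod_cast hp.ne_zero
  have hz : (q : ℤ) ^ (p * p) - (q : ℤ) ^ p = p * (L + 1) := by
    have : (L * p + (q ^ p + p) : ℤ) = (q : ℤ) ^ (p * p) := by exact_mod_cast hcard
    rw [← this]
    ring
  have hneck : necklace (q ^ p) p = L + 1 := by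
    rw [necklace_prime hp, Nat.cast_pow, ← pow_mul, hz, Int.mul_ediv_cancel_left _ hp0]
  have hdvd : (p : ℤ) ∣ L + 1 := by
    have h := prime_sq_dvd_pow_sub_pow hp q
    rw [hz, sq] at h
    exact Int.dvd_of_mul_dvd_mul_left hp0 h
  refine ⟨L, hL, ?_, ?_, A, hA⟩
  · rw [hp.coprime_iff_not_dvd]
    intro h
    have h1 : p ∣ L + 1 := by exact_mod_cast hdvd
    exact hp.one_lt.ne' (Nat.dvd_one.1 ((Nat.dvd_add_right h).1 h1))
  · rw [hneck, ringReduction_of_dvd hp.two_le hdvd]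
    ring

/-! ### Superposition by the Chinese remainder theorem -/

theorem ZMod.eq_of_castHom_eq {a b : ℕ} (hab : a.Coprime b) {x y : ZMod (a * b)}
    (ha : ZMod.castHom (dvd_mul_right a b) (ZMod a) x = ZMod.castHom (dvd_mul_right a b) _ y)
    (hb : ZMod.castHom (dvd_mul_left b a) (ZMod b) x = ZMod.castHom (dvd_mul_left b a) _ y) :
    x = y := by
  refine (ZMod.chineseRemainder hab).injective (Prod.ext ?_ ?_)
  · have h : (RingHom.fst _ _).comp (ZMod.chineseRemainder hab).toRingHom =
        ZMod.castHom (dvd_mul_right a b) (ZMod a) := Subsingleton.elim _ _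
    rw [← h] at ha
    exact ha
  · have h : (RingHom.snd _ _).comp (ZMod.chineseRemainder hab).toRingHom =
        ZMod.castHom (dvd_mul_left b a) (ZMod b) := Subsingleton.elim _ _
    rw [← h] at hb
    exact hb

/-- Superposing an array with few columns and a transposed one gives a sub-perfect map over the
product alphabet: the patterns of the two arrays determine complementary residues of the
position. -/
theorem patternAt_superposition_injective {β γ : Type*} {m n L₁ L₂ : ℕ}
    (hL₁ : n.Coprime L₁) (hL₂ : m.Coprime L₂)
    {A : ZMod L₂ → ZMod n → β} (hA : Function.Injective (patternAt A m n))
    {B : ZMod L₁ → ZMod m → γ} (hB : Function.Injective (patternAt B n m)) :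
    Function.Injective (patternAt (fun (i : ZMod (m * L₂)) (j : ZMod (n * L₁)) =>
      (B (ZMod.castHom (dvd_mul_left L₁ n) _ j) (ZMod.castHom (dvd_mul_right m L₂) _ i),
        A (ZMod.castHom (dvd_mul_left L₂ m) _ i) (ZMod.castHom (dvd_mul_right n L₁) _ j))) m n) := by
  rintro ⟨i, j⟩ ⟨i', j'⟩ h
  have h' := fun a b => Prod.ext_iff.1 (congrFun (congrFun h a) b)
  simp only [patternAt, map_add, map_natCast] at h'
  -- The `A`-layer fixes `i` modulo `L₂` and `j` modulo `n`; the `B`-layer fixes `j` modulo `L₁` and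
  -- `i` modulo `m`.
  have hA' := @hA
    (ZMod.castHom (dvd_mul_left L₂ m) _ i, ZMod.castHom (dvd_mul_right n L₁) _ j)
    (ZMod.castHom (dvd_mul_left L₂ m) _ i', ZMod.castHom (dvd_mul_right n L₁) _ j')
    (by funext a b; exact (h' a b).2)
  have hB' := @hB
    (ZMod.castHom (dvd_mul_left L₁ n) _ j, ZMod.castHom (dvd_mul_right m L₂) _ i)
    (ZMod.castHom (dvd_mul_left L₁ n) _ j', ZMod.castHom (dvd_mul_right m L₂) _ i')
    (by funext b a; exact (h' a b).1)
  rw [Prod.mk.injEq] at hA' hB'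
  exact Prod.ext (ZMod.eq_of_castHom_eq hL₂ hB'.2 hA'.1) (ZMod.eq_of_castHom_eq hL₁ hA'.2 hB'.1)

theorem patternAt_comp_injective {β γ : Type*} {M N m n : ℕ} {A : ZMod M → ZMod N → β}
    (hA : Function.Injective (patternAt A m n)) {f : β → γ} (hf : Function.Injective f) :
    Function.Injective (patternAt (fun i j => f (A i j)) m n) := fun p q h =>
  hA (by funext a b; exact hf (congrFun (congrFun h a) b))

theorem exists_mem_stackedRingMaps_of_prime {α : Type*} [Fintype α] {k₁ k₂ : ℕ} (hk₁ : 2 ≤ k₁)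
    (hk₂ : 2 ≤ k₂) (hα : Fintype.card α = k₁ * k₂) {p : ℕ} (hp : p.Prime) (hp3 : 3 ≤ p) :
    ∃ A ∈ stackedRingMaps α k₁ k₂, A.m = p ∧ A.n = p := by
  obtain ⟨L₂, hL₂, hc₂, hn₂, A, hA⟩ := exists_ring_array hp hp3 hk₂
  obtain ⟨L₁, hL₁, hc₁, hn₁, B, hB⟩ := exists_ring_array hp hp3 hk₁
  have e : Fin k₁ × Fin k₂ ≃ α := Fintype.equivOfCardEq (by simp [hα])
  have hinj := patternAt_comp_injective (patternAt_superposition_injective hc₁ hc₂ hA hB)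
    e.injective
  refine ⟨{ M := p * L₂, N := p * L₁, m := p, n := p
            M_pos := Nat.mul_pos hp.pos hL₂, N_pos := Nat.mul_pos hp.pos hL₁
            m_pos := hp.pos, n_pos := hp.pos
            array := _
            occurs_at_most_once := fun P x y hx hy => hinj (hx.trans hy.symm) },
    ⟨hp.two_le, hp.two_le, ?_, ?_, ?_⟩, rfl, rfl⟩
  · simp
  · dsimp only
    rw [← hn₂, Nat.cast_mul]
  · dsimp only
    rw [← hn₁, Nat.cast_mul]

theorem theorem3 {α : Type*} [Fintype α] (k₁ k₂ : ℕ) (hk₁ : 2 ≤ k₁) (hk₂ : 2 ≤ k₂)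
    (hα : Fintype.card α = k₁ * k₂) :
    IsAlmostPerfectFamily (stackedRingMaps α k₁ k₂) := by
  refine ⟨by rw [hα]; nlinarith, fun m' n' _ _ => ?_, fun A hA hinc => ?_⟩
  · obtain ⟨p, hle, hp⟩ := Nat.exists_infinite_primes (m' + n' + 3)
    obtain ⟨A, hA, hm, hn⟩ := exists_mem_stackedRingMaps_of_prime hk₁ hk₂ hα hp (by omega)
    exact ⟨A, hA, by omega, by omega⟩
  · rw [hα]
    exact tendsto_area_div_of_mem_stackedRingMaps hk₁ hk₂ A hA hinc
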